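/- **Setting.** Transmitters $\mathcal I=\{0,1,\dots,N_B\}$ ($0$ is the HAPS, the others are ground base stations) serve single-antenna users $\mathcal U=\{1,\dots,N_U\}$. The association is fixed: $\gamma_{ij},\alpha_{ij}\in\{0,1\}$ with $\sum_i\gamma_{ij}\alpha_{ij}\le 1$ for every $j$; put $\mathcal U_i=\{j:\gamma_{ij}\alpha_{ij}=1\}$, and call $(i,j)$ with $j\in\mathcal U_i$ a link. Given are channels $\mathbf h_{ij}\in\mathbb C^{N_A^i}$, noise variance $\sigma^2>0$, bandwidth $\beta>0$, power budgets $P_i^{max}\ge 0$ and an FSO backhaul capacity $R^{FSO}>0$. For beamformers $\mathbf w=(\mathbf w_{ij})$, $\mathbf w_{ij}\in\mathbb C^{N_A^i}$, indexed by the links, let $$R_{ij}=\beta\log_2\Bigl(1+\frac{|\mathbf h_{ij}^H\mathbf w_{ij}|^2}{\sum_{(b,l):\,l\in\mathcal U_b,\ l\ne j}|\mathbf h_{bj}^H\mathbf w_{bl}|^2+\sigma^2}\Bigr),\qquad \tau_{0j}=\min\{R_{0j},R^{FSO}\}.$$ The beamforming problem is $$\max_{\mathbf w}\ R_{sum}(\mathbf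 w)=\sum_{i\ne 0}\sum_{j\in\mathcal U_i}R_{ij}+\sum_{j\in\mathcal U_0}\tau_{0j}\quad\text{s.t.}\quad \sum_{j\in\mathcal U_i}\|\mathbf w_{ij}\|^2\le P_i^{max}\ \ \forall i\in\mathcal I .\tag{P}$$ A feasible $\mathbf x$ is a *stationary point* of (P) if for every feasible $\mathbf y$ the one-sided directional derivative of $R_{sum}$ at $\mathbf x$ in the direction $\mathbf y-\mathbf x$ exists and is $\le 0$. **Algorithm (modified WMMSE).** From an arbitrary initial $\mathbf w^0$, repeat for $m=0,1,2,\dots$: 1. weights: $\lambda_{ij}=1$ for $i\neq0$; $\lambda_{0j}=1$ if $\tau_{0j}=R_{0j}$ and $\lambda_{0j}=0$ if $\tau_{0j}=R^{FSO}$ (either value in case of a tie), evaluated at $\mathbf w^m$; 2. MMSE receivers: $u_{ij}=\mathbf h_{ij}^H\mathbf w_{ij}^m\big/\bigl(\sum_{b}\sum_{l\in\mathcal U_b}|\mathbf h_{bj}^H\mathbf w_{bl}^m|^2+\sigma^2\bigr)$; 3. MSE weights: $\rho_{ij}=e_{ij}^{-1}$, where $e_{ij}(u,\mathbf w)=|1-\overline{u_{ij}}\,\mathbf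 h_{ij}^H\mathbf w_{ij}|^2+\sum_{(b,l)\ne(i,j)}|u_{ij}\mathbf h_{bj}^H\mathbf w_{bl}|^2+\sigma^2|u_{ij}|^2$ is evaluated at $(u,\mathbf w^m)$; 4. beamformers: $\mathbf w^{m+1}$ minimizes $\sum_{i}\sum_{j\in\mathcal U_i}\lambda_{ij}\bigl(\rho_{ij}e_{ij}(u,\mathbf w)-\log\rho_{ij}\bigr)$ over the feasible $\mathbf w$ with $\lambda,\rho,u$ fixed. If there are several minimizers, one is taken that wastes no power on the HAPS links: if replacing $\mathbf w^{m+1}_{0j}$ by $0$ does not change the value of this objective, then $\mathbf w^{m+1}_{0j}=0$. **Lemma 1.** For a fixed user association and every initial $\mathbf w^0$, the algorithm has an infinite run from $\mathbf w^0$, and every such run $(\mathbf w^m)$ converges to stationary points of (P) in the following sense: $(\mathbf w^m)$ has a limit point; $R_{sum}(\mathbf w^m)$ converges to some $L\in\mathbb R$; every limit point $\mathbf x$ of $(\mathbf w^m)$ is a stationary point of (P) with $R_{sum}(\mathbf x)=L$; and the distance of $\mathbf w^m$ to the set of stationary points of (P) tends to $0$. -/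

import Mathlib

open Filter Topology

noncomputable section

/-- A downlink network with a fixed user association. Transmitter `0` is the HAPS, the transmitters
`1, …, NB` are the ground base stations, and users have a single receive antenna. -/
structure Network where
  /-- number of ground base stations -/
  NB : ℕ
  /-- number of users -/
  NU : ℕ
  /-- number of antennas of each transmitter -/
  antennas : Fin (NB + 1) → ℕ
  /-- data availability -/
  γ : Fin (NB + 1) → Fin NU → Bool
  /-- user association -/
  α : Fin (NB + 1) → Fin NU → Bool
  /-- each user is served by at most one transmitter -/
  single : ∀ j, ∑ i, (γ i j && α i j).toNat ≤ 1
  /-- channel vectors -/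
  h : ∀ i, Fin NU → EuclideanSpace ℂ (Fin (antennas i))
  /-- noise standard deviation -/
  σ : ℝ
  σ_pos : 0 < σ
  /-- transmission bandwidth -/
  β : ℝ
  β_pos : 0 < β
  /-- power budgets -/
  Pmax : Fin (NB + 1) → ℝ
  Pmax_nonneg : ∀ i, 0 ≤ Pmax i
  /-- capacity of the FSO backhaul link of the HAPS -/
  RFSO : ℝ
  RFSO_pos : 0 < RFSO

namespace Network

variable (N : Network)

/-- The active links: pairs (transmitter `i`, user `j`) such that `i` serves `j`. -/
abbrev Link : Type :=
  {p : Fin (N.NB + 1) × Fin N.NU // (N.γ p.1 p.2 && N.α p.1 p.2) = true}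

variable {N}

/-- The transmitter of a link. -/
abbrev Link.tx (p : N.Link) : Fin (N.NB + 1) := p.1.1

/-- The user of a link. -/
abbrev Link.user (p : N.Link) : Fin N.NU := p.1.2

variable (N)

/-- Families of transmit beamforming vectors, one for each active link. -/
abbrev Beams : Type := ∀ p : N.Link, EuclideanSpace ℂ (Fin (N.antennas p.tx))

variable {N}

/-- The complex gain `h_{bj}ᴴ w_{bl}` with which the signal of the link `q = (b, l)` is received by
user `j`. -/
def gain (w : N.Beams) (q : N.Link) (j : Fin N.NU) : ℂ :=
  inner ℂ (N.h q.tx j) (w q)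

/-- Signal-to-interference-plus-noise ratio. -/
def sinr (w : N.Beams) (p : N.Link) : ℝ :=
  ‖gain w p p.user‖ ^ 2 /
    (∑ q : N.Link with q.user ≠ p.user, ‖gain w q p.user‖ ^ 2 + N.σ ^ 2)

/-- Achievable RF rate. -/
def rate (w : N.Beams) (p : N.Link) : ℝ :=
  N.β * Real.logb 2 (1 + sinr w p)

/-- Rate of a HAPS link, capped by the FSO backhaul. -/
def tau (w : N.Beams) (p : N.Link) : ℝ :=
  min (rate w p) N.RFSO

/-- The objective of the beamforming problem: the network sum-rate. -/
def sumRate (w : N.Beams) : ℝ :=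
  ∑ p : N.Link, if p.tx = 0 then tau w p else rate w p

variable (N)

/-- The beamformers that satisfy all the power constraints. -/
def feasible : Set N.Beams :=
  {w | ∀ i, ∑ p : N.Link with p.tx = i, ‖w p‖ ^ 2 ≤ N.Pmax i}

variable {N}

/-- First-order stationarity for the maximization of `sumRate` over the convex set `feasible`: at the
feasible point `x` the one-sided directional derivative of the objective towards each feasible point
exists and is nonpositive. The objective need not be differentiable where a HAPS rate meets the cap. -/
def IsStationary (x : N.Beams) : Prop :=
  x ∈ N.feasible ∧ ∀ y ∈ N.feasible, ∃ D ≤ (0 : ℝ),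
    HasDerivWithinAt (fun t : ℝ => sumRate (x + t • (y - x))) D (Set.Ici 0) 0

/-- The rule for the weights of the rate terms: `1` for ground links; for a HAPS link `1` if
the RF rate attains the minimum and `0` if the FSO rate does (either value if both do). -/
def IsWeight (w : N.Beams) (lam : N.Link → ℝ) : Prop :=
  ∀ p : N.Link,
    (p.tx ≠ 0 → lam p = 1) ∧
    (p.tx = 0 → (lam p = 1 ∧ tau w p = rate w p) ∨ (lam p = 0 ∧ tau w p = N.RFSO))

/-- Mean squared error of a link with (scalar) receivers `u`. -/
def mse (u : N.Link → ℂ) (w : N.Beams) (p : N.Link) : ℝ :=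
  ‖1 - star (u p) * gain w p p.user‖ ^ 2
    + ∑ q : N.Link with q ≠ p, ‖u p * gain w q p.user‖ ^ 2
    + N.σ ^ 2 * ‖u p‖ ^ 2

/-- The objective of the weighted MSE minimization problem. -/
def wmmse (lam ρ : N.Link → ℝ) (u : N.Link → ℂ) (w : N.Beams) : ℝ :=
  ∑ p : N.Link, lam p * (ρ p * mse u w p - Real.log (ρ p))

/-- The MMSE receivers. -/
def mmseReceiver (w : N.Beams) (p : N.Link) : ℂ :=
  gain w p p.user / ((∑ q : N.Link, ‖gain w q p.user‖ ^ 2 + N.σ ^ 2 : ℝ) : ℂ)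

/-- `w` is an outcome of the transmit beamformer update with the weights `lam`, `ρ` and the receivers
`u` held fixed: it is optimal, and it spends no power on a HAPS link that can be switched off
without loss of optimality. -/
def IsBeamUpdate (lam ρ : N.Link → ℝ) (u : N.Link → ℂ) (w : N.Beams) : Prop :=
  IsMinOn (wmmse lam ρ u) N.feasible w ∧ w ∈ N.feasible ∧
    ∀ p : N.Link, p.tx = 0 →
      wmmse lam ρ u (Function.update w p 0) = wmmse lam ρ u w → w p = 0

variable (N)

/-- An infinite run of the modified WMMSE iteration. -/
structure Run where
  w : ℕ → N.Beams
  lam : ℕ → N.Link → ℝ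
  u : ℕ → N.Link → ℂ
  ρ : ℕ → N.Link → ℝ
  weight_step : ∀ m, IsWeight (w m) (lam m)
  receiver_step : ∀ m, u m = mmseReceiver (w m)
  mse_weight_step : ∀ m p, ρ m p = (mse (u m) (w m) p)⁻¹
  beam_step : ∀ m, IsBeamUpdate (lam m) (ρ m) (u m) (w (m + 1))

end Network

end

/-! The cap matters only finitely often. A HAPS link of weight 0 is switched off by the next update,
since its beam could only interfere; a zero beam gives a zero receiver, so it stays off, and its
rate 0 lies strictly below the cap, so its weight is 1 from then on. Hence eventually all weights
are 1 (`Run.eventually_lam_eq_one`), all HAPS rates are at most the cap, and the objective is a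
constant multiple of `logRate`.

From then on the run is majorization-minimization: `surrogate v` lies above `card - logRate`, with
equality at `v`. So `logRate` increases and converges, and in the limit each cluster point minimizes
its own surrogate. Tangency turns this into first-order stationarity of `logRate`, and the cap can
only lower one-sided derivatives where a rate meets it. Compactness of the feasible set gives the
rest. -/

/-- The capped function `min f c` has a right derivative, at most that of `f`, wherever `f ≤ c`. -/
theorem exists_hasDerivWithinAt_min {f : ℝ → ℝ} {f' c : ℝ} (hf : HasDerivAt f f' 0) (h0 : f 0 ≤ c) :
    ∃ D ≤ f', HasDerivWithinAt (fun t => min (f t) c) D (Set.Ici 0) 0 := by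
  rcases h0.lt_or_eq with h | h
  · refine ⟨f', le_rfl, (hf.congr_of_eventuallyEq ?_).hasDerivWithinAt⟩
    filter_upwards [hf.continuousAt.eventually (gt_mem_nhds h)] with t ht
    exact min_eq_left ht.le
  -- At a tie the slopes of the capped function for `t > 0` are the minimum of the slope of `f` and
  -- 0.
  · refine ⟨min f' 0, min_le_left _ _, ?_⟩
    have hs := hasDerivWithinAt_iff_tendsto_slope.1 (hf.hasDerivWithinAt (s := Set.Ici 0))
    rw [hasDerivWithinAt_iff_tendsto_slope]
    refine (hs.min tendsto_const_nhds).congr' ?_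
    filter_upwards [self_mem_nhdsWithin] with t ht
    have ht0 : 0 < t := lt_of_le_of_ne ht.1 (fun e => ht.2 e.symm)
    have hi : 0 ≤ (t - 0)⁻¹ := by rw [sub_zero]; positivity
    simp only [slope_def_field, div_eq_inv_mul]
    rw [h, min_self, ← min_sub_sub_right, sub_self, mul_min_of_nonneg _ _ hi, mul_zero]

/-- Completing the square in `u`: the MMSE receiver is the minimizer and `1 / (1 + SINR)` the
minimum. -/
theorem mse_scalar_identity (u g : ℂ) {J : ℝ} (hJ : 0 < J) :
    ‖1 - star u * g‖ ^ 2 + ‖u‖ ^ 2 * J =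
      (1 + ‖g‖ ^ 2 / J)⁻¹ + (‖g‖ ^ 2 + J) * ‖u - g / ((‖g‖ ^ 2 + J : ℝ) : ℂ)‖ ^ 2 := by
  have hT : 0 < ‖g‖ ^ 2 + J := by positivity
  have h1 : (1 + ‖g‖ ^ 2 / J)⁻¹ = J / (‖g‖ ^ 2 + J) := by field_simp; ring
  rw [h1]
  generalize hTd : ‖g‖ ^ 2 + J = T at *
  have hg : ‖g‖ ^ 2 = g.re * g.re + g.im * g.im := by rw [← Complex.normSq_eq_norm_sq]; rfl
  have hJ' : J = T - (g.re * g.re + g.im * g.im) := by rw [← hTd, hg]; ring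
  simp only [← Complex.normSq_eq_norm_sq, Complex.normSq_apply, Complex.sub_re, Complex.sub_im,
    Complex.mul_re, Complex.mul_im, Complex.div_ofReal_re, Complex.div_ofReal_im, Complex.one_re,
    Complex.one_im, Complex.star_def, Complex.conj_re, Complex.conj_im]
  rw [hJ']
  field_simp
  ring

/-- A sequence that eventually stays in a compact set approaches any set containing its cluster
points. -/
theorem tendsto_infDist_of_mapClusterPt {X : Type*} [PseudoMetricSpace X] {K S : Set X}
    (hK : IsCompact K) {x : ℕ → X} (hx : ∀ᶠ m in atTop, x m ∈ K)
    (hS : ∀ a, MapClusterPt a atTop x → a ∈ S) :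
    Tendsto (fun m => Metric.infDist (x m) S) atTop (𝓝 0) := by
  rw [Metric.tendsto_atTop']
  by_contra! hcon
  obtain ⟨ε, hε, hfreq⟩ := hcon
  have hf : ∃ᶠ m in atTop, x m ∈ K ∩ {a | ε ≤ Metric.infDist a S} := by
    refine (Filter.Frequently.and_eventually ?_ hx).mono fun m hm => ⟨hm.2, hm.1⟩
    rw [frequently_atTop']
    intro n
    obtain ⟨m, hm, h⟩ := hfreq n
    refine ⟨m, hm, ?_⟩
    simpa [abs_of_nonneg Metric.infDist_nonneg] using h
  have hc : IsCompact (K ∩ {a | ε ≤ Metric.infDist a S}) :=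
    hK.inter_right (isClosed_le continuous_const (Metric.continuous_infDist_pt S))
  obtain ⟨a, ha, hcl⟩ := hc.exists_mapClusterPt_of_frequently hf
  have h0 := Metric.infDist_zero_of_mem (hS a hcl)
  have h1 : ε ≤ Metric.infDist a S := ha.2
  linarith

/-! ### SINR, mean squared error and the surrogate -/

namespace Network

variable {N : Network}

/-- Two transmitters serving one user would violate `single`. This reconciles the interference sum
over other users (`sinr`) with the sum over other links (`mse`). -/
theorem Link.eq_of_user_eq {p q : N.Link} (h : q.user = p.user) : q = p := by
  have h1 := N.single p.user
  by_contra hne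
  have htx : q.tx ≠ p.tx := fun e => hne (Subtype.ext (Prod.ext e h))
  have h2 := Finset.add_le_sum (s := Finset.univ)
    (f := fun i => (N.γ i p.user && N.α i p.user).toNat) (fun _ _ => Nat.zero_le _)
    (Finset.mem_univ q.tx) (Finset.mem_univ p.tx) htx
  have hq := q.2
  change (N.γ q.tx q.user && N.α q.tx q.user) = true at hq
  have hp := p.2
  change (N.γ p.tx p.user && N.α p.tx p.user) = true at hp
  rw [h] at hq
  simp only [hq, hp, Bool.toNat_true] at h2
  omega

theorem Link.user_ne_iff {p q : N.Link} : q.user ≠ p.user ↔ q ≠ p :=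
  not_congr ⟨Link.eq_of_user_eq, fun h => h ▸ rfl⟩

/-- Interference plus noise power of a link. -/
noncomputable def noise (w : N.Beams) (p : N.Link) : ℝ :=
  ∑ q : N.Link with q ≠ p, ‖gain w q p.user‖ ^ 2 + N.σ ^ 2

theorem noise_pos (w : N.Beams) (p : N.Link) : 0 < noise w p := by
  have := N.σ_pos
  unfold noise
  positivity

theorem sinr_eq (w : N.Beams) (p : N.Link) : sinr w p = ‖gain w p p.user‖ ^ 2 / noise w p := by
  simp only [sinr, noise, Link.user_ne_iff]

theorem sinr_nonneg (w : N.Beams) (p : N.Link) : 0 ≤ sinr w p := by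
  rw [sinr_eq]
  have := noise_pos w p
  positivity

theorem mse_eq_scalar (u : N.Link → ℂ) (w : N.Beams) (p : N.Link) :
    mse u w p = ‖1 - star (u p) * gain w p p.user‖ ^ 2 + ‖u p‖ ^ 2 * noise w p := by
  simp only [mse, noise, norm_mul, mul_pow, ← Finset.mul_sum]
  ring

theorem mmseReceiver_eq (w : N.Beams) (p : N.Link) :
    mmseReceiver w p =
      gain w p p.user / ((‖gain w p p.user‖ ^ 2 + noise w p : ℝ) : ℂ) := by
  have h : ∑ q : N.Link, ‖gain w q p.user‖ ^ 2 + N.σ ^ 2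
      = ‖gain w p p.user‖ ^ 2 + noise w p := by
    rw [noise, ← Finset.add_sum_erase _ _ (Finset.mem_univ p), Finset.filter_ne']
    ring
  rw [mmseReceiver, h]

theorem inv_le_mse (u : N.Link → ℂ) (w : N.Beams) (p : N.Link) :
    (1 + sinr w p)⁻¹ ≤ mse u w p := by
  have := noise_pos w p
  rw [mse_eq_scalar, mse_scalar_identity _ _ this, sinr_eq]
  exact le_add_of_nonneg_right (by positivity)

theorem mse_mmseReceiver (w : N.Beams) (p : N.Link) :
    mse (mmseReceiver w) w p = (1 + sinr w p)⁻¹ := by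
  rw [mse_eq_scalar, mse_scalar_identity _ _ (noise_pos w p), sinr_eq, mmseReceiver_eq]
  simp

/-- Sum-rate without the backhaul cap, in nats and per unit of bandwidth. -/
noncomputable def logRate (w : N.Beams) : ℝ := ∑ p : N.Link, Real.log (1 + sinr w p)

/-- The weighted MSE objective that the algorithm sets up at `v`, with all rate weights `1`. -/
noncomputable def surrogate (v w : N.Beams) : ℝ :=
  wmmse 1 (fun p => 1 + sinr v p) (mmseReceiver v) w

theorem surrogate_self (v : N.Beams) :
    surrogate v v = Fintype.card N.Link - logRate v := by
  have h (p : N.Link) : (1 + sinr v p) ≠ 0 := by linarith [sinr_nonneg v p]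
  simp [surrogate, wmmse, mse_mmseReceiver, logRate, h]

/-- Termwise `log x ≤ x - 1` at `x = ρ * mse`, combined with `inv_le_mse`. -/
theorem card_sub_logRate_le_surrogate (v w : N.Beams) :
    Fintype.card N.Link - logRate w ≤ surrogate v w := by
  have e : (Fintype.card N.Link : ℝ) - logRate w = ∑ p : N.Link, (1 - Real.log (1 + sinr w p)) := by
    simp [logRate]
  rw [e, surrogate, wmmse]
  refine Finset.sum_le_sum fun p _ => ?_
  have hv : 0 < 1 + sinr v p := by linarith [sinr_nonneg v p]
  have hw : 0 < 1 + sinr w p := by linarith [sinr_nonneg w p]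
  have h1 := inv_le_mse (mmseReceiver v) w p
  have hm : 0 < mse (mmseReceiver v) w p := lt_of_lt_of_le (by positivity) h1
  have h2 := Real.log_le_sub_one_of_pos (mul_pos hv hm)
  rw [Real.log_mul hv.ne' hm.ne'] at h2
  have h3 := Real.log_le_log (by positivity) h1
  rw [Real.log_inv] at h3
  simp only [Pi.one_apply, one_mul]
  linarith

/-! ### Regularity -/

theorem differentiable_gain (q : N.Link) (j : Fin N.NU) :
    Differentiable ℝ fun w : N.Beams => gain w q j :=
  (((innerSL ℂ (N.h q.tx j)).restrictScalars ℝ).comp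
    (ContinuousLinearMap.proj (R := ℝ) (φ := fun p : N.Link =>
      EuclideanSpace ℂ (Fin (N.antennas p.tx))) q)).differentiable

theorem differentiable_noise (p : N.Link) : Differentiable ℝ fun w : N.Beams => noise w p := by
  unfold noise
  exact (Differentiable.fun_sum fun q _ => (differentiable_gain q p.user).norm_sq ℝ).add_const _

theorem differentiable_sinr (p : N.Link) : Differentiable ℝ fun w : N.Beams => sinr w p := by
  simp only [sinr_eq]
  simp only [div_eq_mul_inv]
  exact ((differentiable_gain p p.user).norm_sq ℝ).mul
    ((differentiable_noise p).inv fun w => (noise_pos w p).ne')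

theorem differentiable_log_one_add_sinr (p : N.Link) :
    Differentiable ℝ fun w : N.Beams => Real.log (1 + sinr w p) :=
  ((differentiable_sinr p).const_add 1).log fun w => by linarith [sinr_nonneg w p]

theorem differentiable_logRate : Differentiable ℝ (logRate : N.Beams → ℝ) :=
  Differentiable.fun_sum fun p _ => differentiable_log_one_add_sinr p

theorem rate_eq (w : N.Beams) (p : N.Link) :
    rate w p = N.β / Real.log 2 * Real.log (1 + sinr w p) := by
  rw [rate, Real.logb]; ring

theorem differentiable_rate (p : N.Link) : Differentiable ℝ fun w : N.Beams => rate w p := by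
  simp only [rate_eq]
  exact (differentiable_log_one_add_sinr p).const_mul _

theorem sum_rate_eq (w : N.Beams) :
    ∑ p : N.Link, rate w p = N.β / Real.log 2 * logRate w := by
  simp only [rate_eq, logRate, Finset.mul_sum]

theorem differentiable_wmmse (lam ρ : N.Link → ℝ) (u : N.Link → ℂ) :
    Differentiable ℝ (wmmse lam ρ u : N.Beams → ℝ) := by
  unfold wmmse
  simp only [mse_eq_scalar]
  refine Differentiable.fun_sum fun p _ => ((Differentiable.const_mul ?_ _).sub_const _).const_mul _
  exact ((((differentiable_gain p p.user).const_mul _).const_sub 1).norm_sq ℝ).add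
    ((differentiable_noise p).const_mul _)

theorem continuous_mmseReceiver (p : N.Link) :
    Continuous fun v : N.Beams => mmseReceiver v p := by
  simp only [mmseReceiver_eq]
  have h1 := (differentiable_gain p p.user).continuous
  have h2 := (differentiable_noise p).continuous
  refine h1.div (Complex.continuous_ofReal.comp ((h1.norm.pow 2).add h2)) fun v => ?_
  have := noise_pos v p
  exact Complex.ofReal_ne_zero.2 (by positivity)

theorem continuous_surrogate_left (w : N.Beams) : Continuous fun v => surrogate v w := by
  unfold surrogate wmmse
  simp only [mse_eq_scalar]
  refine continuous_finsetSum _ fun p _ => ?_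
  have h1 := (differentiable_sinr p).continuous
  have h2 := continuous_mmseReceiver p
  have h3 := (differentiable_log_one_add_sinr p).continuous
  fun_prop

theorem continuous_sumRate : Continuous (sumRate : N.Beams → ℝ) := by
  unfold sumRate tau
  refine continuous_finsetSum _ fun p _ => ?_
  have h := (differentiable_rate p).continuous
  split_ifs
  · exact h.min continuous_const
  · exact h

/-! ### The feasible set -/

theorem zero_mem_feasible : (0 : N.Beams) ∈ N.feasible := fun i => by
  simpa using N.Pmax_nonneg i

theorem isClosed_feasible : IsClosed N.feasible := by
  simp only [feasible, Set.ofPred_forall]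
  exact isClosed_iInter fun i => isClosed_le
    (continuous_finsetSum _ fun p _ => (continuous_apply p).norm.pow 2) continuous_const

theorem isCompact_feasible : IsCompact N.feasible := by
  refine Metric.isCompact_of_isClosed_isBounded isClosed_feasible ?_
  -- The `+ 1` bounds a norm by a bound on its square without taking roots.
  refine (Metric.isBounded_iff_subset_closedBall 0).2 ⟨∑ i, (N.Pmax i + 1), fun w hw => ?_⟩
  have hnn : ∀ i ∈ Finset.univ, 0 ≤ N.Pmax i + 1 := fun i _ => by linarith [N.Pmax_nonneg i]
  rw [mem_closedBall_zero_iff, pi_norm_le_iff_of_nonneg (Finset.sum_nonneg hnn)]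
  intro p
  have h1 : ‖w p‖ ^ 2 ≤ N.Pmax p.tx :=
    (Finset.single_le_sum (f := fun p => ‖w p‖ ^ 2) (fun _ _ => sq_nonneg _)
      (by simp : p ∈ Finset.univ.filter fun q : N.Link => q.tx = p.tx)).trans (hw p.tx)
  have h2 := Finset.single_le_sum hnn (Finset.mem_univ p.tx)
  nlinarith [sq_nonneg (‖w p‖ - 1)]

theorem convex_feasible : Convex ℝ N.feasible := by
  have h : N.feasible = ⋂ i, {w : N.Beams | w ∈ Set.univ ∧
      ∑ p : N.Link with p.tx = i, ‖w p‖ ^ 2 ≤ N.Pmax i} := by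
    ext; simp [feasible]
  rw [h]
  refine convex_iInter fun i => ConvexOn.convex_le ?_ _
  refine ⟨convex_univ, fun x _ y _ a b ha hb hab => ?_⟩
  simp only [smul_eq_mul, Finset.mul_sum, ← Finset.sum_add_distrib]
  refine Finset.sum_le_sum fun p _ => ?_
  have := (convexOn_univ_norm (E := EuclideanSpace ℂ (Fin (N.antennas p.tx)))).pow
    (fun _ _ => norm_nonneg _) 2
  exact this.2 (Set.mem_univ (x p)) (Set.mem_univ (y p)) ha hb hab

theorem update_zero_mem_feasible {w : N.Beams} (hw : w ∈ N.feasible) (p : N.Link) :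
    Function.update w p 0 ∈ N.feasible := fun i => by
  refine (Finset.sum_le_sum fun q _ => ?_).trans (hw i)
  rcases eq_or_ne q p with rfl | h
  · simp only [Function.update_self, norm_zero]
    nlinarith [sq_nonneg ‖w q‖]
  · rw [Function.update_of_ne h]

/-! ### Existence of runs -/

theorem exists_isWeight (w : N.Beams) : ∃ lam, IsWeight w lam := by
  refine ⟨fun p => if p.tx = 0 ∧ N.RFSO ≤ rate w p then 0 else 1, fun p => ⟨fun h => ?_, fun h => ?_⟩⟩
  · simp [h]
  · by_cases h' : N.RFSO ≤ rate w p
    · right; simp [h, h', tau]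
    · left; simp [h, h', tau, (not_le.1 h').le]

theorem exists_isBeamUpdate (lam ρ : N.Link → ℝ) (u : N.Link → ℂ) :
    ∃ w : N.Beams, IsBeamUpdate lam ρ u w := by
  classical
  obtain ⟨w, hw, hmin⟩ := isCompact_feasible.exists_isMinOn ⟨0, zero_mem_feasible (N := N)⟩
    (differentiable_wmmse lam ρ u).continuous.continuousOn
  let s : Set N.Beams := {w | IsMinOn (wmmse lam ρ u) N.feasible w ∧ w ∈ N.feasible}
  let f : N.Beams → ℕ := fun w => (Finset.univ.filter fun p => w p ≠ 0).card
  -- A minimizer with the fewest nonzero beams: a beam removable at no cost would contradict this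
  -- choice.
  obtain ⟨v, ⟨hvm, hvf⟩, hv⟩ : ∃ v ∈ s, ∀ v' ∈ s, f v ≤ f v' :=
    ⟨_, Function.argminOn_mem f s ⟨w, hmin, hw⟩, fun v' hv' => Function.argminOn_le f s hv'⟩
  refine ⟨v, hvm, hvf, fun p _ he => ?_⟩
  by_contra hne
  refine (hv (Function.update v p 0) ⟨fun y hy => ?_, update_zero_mem_feasible hvf p⟩).not_gt ?_
  · simpa only [Set.mem_ofPred_eq, he] using hvm hy
  · refine Finset.card_lt_card (Finset.ssubset_iff_of_subset ?_ |>.2 ⟨p, by simp [hne], by simp⟩)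
    intro q
    rcases eq_or_ne q p with rfl | h
    · simp
    · simp [Function.update_of_ne h]

theorem exists_run (w₀ : N.Beams) : ∃ run : N.Run, run.w 0 = w₀ := by
  choose lam hlam using exists_isWeight (N := N)
  choose next hnext using exists_isBeamUpdate (N := N)
  let ρ : N.Beams → N.Link → ℝ := fun w p => (mse (mmseReceiver w) w p)⁻¹
  let w : ℕ → N.Beams := fun m =>
    Nat.rec w₀ (fun _ v => next (lam v) (ρ v) (mmseReceiver v)) m
  exact ⟨⟨w, fun m => lam (w m), fun m => mmseReceiver (w m), fun m => ρ (w m),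
    fun m => hlam _, fun _ => rfl, fun _ _ => rfl, fun m => hnext _ _ _⟩, rfl⟩

/-! ### Weights along a run -/

theorem gain_update_zero_norm_le (w : N.Beams) (p q : N.Link) (j : Fin N.NU) :
    ‖gain (Function.update w p 0) q j‖ ≤ ‖gain w q j‖ := by
  rcases eq_or_ne q p with rfl | h
  · simp [gain]
  · simp [gain, Function.update_of_ne h]

theorem noise_update_zero_le (w : N.Beams) (p q : N.Link) :
    noise (Function.update w p 0) q ≤ noise w q := by
  unfold noise
  gcongr
  exact gain_update_zero_norm_le w p _ _

/-- A HAPS link whose own rate term does not depend on its beam is switched off. -/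
theorem IsBeamUpdate.eq_zero {lam ρ : N.Link → ℝ} {u : N.Link → ℂ} {w : N.Beams}
    (hw : IsBeamUpdate lam ρ u w) (hlam : ∀ q, 0 ≤ lam q) (hρ : ∀ q, 0 ≤ ρ q) {p : N.Link}
    (hp : p.tx = 0) (h : lam p = 0 ∨ u p = 0) : w p = 0 := by
  refine hw.2.2 p hp (le_antisymm ?_ (hw.1 (update_zero_mem_feasible hw.2.1 p)))
  -- Termwise: switching `p` off lowers the noise of the other links, and the own term of `p` does
  -- not increase.
  refine Finset.sum_le_sum fun q _ => ?_
  by_cases hq : q = p ∧ lam p = 0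
  · obtain ⟨rfl, h0⟩ := hq
    simp [h0]
  refine mul_le_mul_of_nonneg_left (sub_le_sub_right (mul_le_mul_of_nonneg_left ?_ (hρ q)) _)
    (hlam q)
  rw [mse_eq_scalar, mse_eq_scalar]
  have hn := mul_le_mul_of_nonneg_left (noise_update_zero_le w p q) (sq_nonneg ‖u q‖)
  rcases eq_or_ne q p with rfl | hne
  · have hu : u q = 0 := h.resolve_left fun h0 => hq ⟨rfl, h0⟩
    simp [hu]
  · have hg : gain (Function.update w p 0) q q.user = gain w q q.user := by
      simp [gain, Function.update_of_ne hne]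
    rw [hg]
    linarith

namespace Run

variable (run : N.Run)

theorem ρ_eq (m : ℕ) : run.ρ m = fun p => 1 + sinr (run.w m) p := by
  funext p
  rw [run.mse_weight_step, run.receiver_step, mse_mmseReceiver, inv_inv]

theorem ρ_nonneg (m : ℕ) (p : N.Link) : 0 ≤ run.ρ m p := by
  rw [run.ρ_eq]
  linarith [sinr_nonneg (run.w m) p]

theorem lam_nonneg (m : ℕ) (p : N.Link) : 0 ≤ run.lam m p := by
  have h := run.weight_step m p
  by_cases hp : p.tx = 0
  · rcases h.2 hp with h | h <;> simp [h.1]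
  · simp [h.1 hp]

theorem w_succ_mem_feasible (m : ℕ) : run.w (m + 1) ∈ N.feasible := (run.beam_step m).2.1

theorem eventually_w_mem_feasible : ∀ᶠ m in atTop, run.w m ∈ N.feasible := by
  filter_upwards [eventually_ge_atTop 1] with m hm
  obtain ⟨k, rfl⟩ := Nat.exists_eq_add_of_le' hm
  exact run.w_succ_mem_feasible k

theorem w_succ_eq_zero {m : ℕ} {p : N.Link} (hp : p.tx = 0)
    (h : run.lam m p = 0 ∨ run.w m p = 0) : run.w (m + 1) p = 0 := by
  refine (run.beam_step m).eq_zero (run.lam_nonneg m) (run.ρ_nonneg m) hp (h.imp_right fun h0 => ?_)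
  simp [run.receiver_step, mmseReceiver, gain, h0]

/-- The rate is 0, and `RFSO_pos` excludes a tie with the cap. -/
theorem lam_eq_one_of_eq_zero {m : ℕ} {p : N.Link} (hp : p.tx = 0) (h : run.w m p = 0) :
    run.lam m p = 1 := by
  rcases (run.weight_step m p).2 hp with h1 | h1
  · exact h1.1
  · have := h1.2
    simp [tau, rate, sinr, gain, h, N.RFSO_pos.not_ge] at this

/-- A HAPS link is weighted by `0` at most once; after that it stays off. -/
theorem eventually_lam_eq_one : ∀ᶠ m in atTop, run.lam m = 1 := by
  simp only [funext_iff, Pi.one_apply]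
  rw [eventually_all]
  intro p
  by_cases hp : p.tx = 0
  swap
  · exact Eventually.of_forall fun m => (run.weight_step m p).1 hp
  by_cases hone : ∀ m, run.lam m p = 1
  · exact Eventually.of_forall hone
  push Not at hone
  obtain ⟨m, hm⟩ := hone
  have h0 : run.lam m p = 0 := by
    rcases (run.weight_step m p).2 hp with h | h
    · exact absurd h.1 hm
    · exact h.1
  filter_upwards [eventually_ge_atTop (m + 1)] with k hk
  refine run.lam_eq_one_of_eq_zero hp ?_
  induction k, hk using Nat.le_induction with
  | base => exact run.w_succ_eq_zero hp (Or.inl h0)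
  | succ k _ ih => exact run.w_succ_eq_zero hp (Or.inr ih)

theorem rate_le_of_lam_eq_one {m : ℕ} (h : run.lam m = 1) {p : N.Link} (hp : p.tx = 0) :
    rate (run.w m) p ≤ N.RFSO := by
  rcases (run.weight_step m p).2 hp with h1 | h1
  · exact min_eq_left_iff.1 h1.2
  · simp [h] at h1

theorem sumRate_eq_of_lam_eq_one {m : ℕ} (h : run.lam m = 1) :
    sumRate (run.w m) = N.β / Real.log 2 * logRate (run.w m) := by
  rw [← sum_rate_eq, sumRate]
  refine Finset.sum_congr rfl fun p _ => ?_
  split_ifs with hp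
  · exact min_eq_left (run.rate_le_of_lam_eq_one h hp)
  · rfl

/-! ### Monotone convergence of the uncapped rate -/

theorem surrogate_succ_le {m : ℕ} (h : run.lam m = 1) {y : N.Beams} (hy : y ∈ N.feasible) :
    surrogate (run.w m) (run.w (m + 1)) ≤ surrogate (run.w m) y := by
  have := (run.beam_step m).1 hy
  rw [h, run.ρ_eq, run.receiver_step] at this
  exact this

theorem logRate_le_succ {m : ℕ} (h : run.lam m = 1) (hm : run.w m ∈ N.feasible) :
    logRate (run.w m) ≤ logRate (run.w (m + 1)) := by
  have h1 := run.surrogate_succ_le h hm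
  have h2 := card_sub_logRate_le_surrogate (run.w m) (run.w (m + 1))
  rw [surrogate_self] at h1
  linarith

theorem exists_tendsto_logRate :
    ∃ L : ℝ, Tendsto (fun m => logRate (run.w m)) atTop (𝓝 L) := by
  obtain ⟨M, hM⟩ := eventually_atTop.1 run.eventually_lam_eq_one
  -- The shift is `M + 1` because the initial point may be infeasible; later iterates are not.
  have hmono : Monotone fun k => logRate (run.w (k + (M + 1))) :=
    monotone_nat_of_le_succ fun k => by
      have := run.logRate_le_succ (hM (k + (M + 1)) (by omega)) (run.w_succ_mem_feasible (k + M))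
      rwa [Nat.add_right_comm] at this
  obtain ⟨B, hB⟩ := (isCompact_feasible (N := N)).bddAbove_image
    differentiable_logRate.continuous.continuousOn
  have hb : BddAbove (Set.range fun k => logRate (run.w (k + (M + 1)))) := by
    refine ⟨B, ?_⟩
    rintro _ ⟨k, rfl⟩
    exact hB ⟨_, run.w_succ_mem_feasible (k + M), rfl⟩
  exact ⟨_, (tendsto_add_atTop_iff_nat (M + 1)).1 (tendsto_atTop_ciSup hmono hb)⟩

end Run

/-! ### Stationarity -/

/-- A fixed point of the beam update with all weights `1` is a stationary point. -/
theorem isStationary_of_isMinOn_surrogate {x : N.Beams} (hx : x ∈ N.feasible)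
    (hmin : IsMinOn (surrogate x) N.feasible x)
    (hcap : ∀ p : N.Link, p.tx = 0 → rate x p ≤ N.RFSO) : IsStationary x := by
  refine ⟨hx, fun y hy => ?_⟩
  let line : ℝ → N.Beams := fun t => x + t • (y - x)
  have hline0 : line 0 = x := by simp [line]
  have hline : Differentiable ℝ line :=
    (differentiable_id.smul_const (y - x)).const_add x
  have hG := ((differentiable_logRate (N := N)).comp hline 0).hasDerivAt
  have hsur : Differentiable ℝ (surrogate x) := differentiable_wmmse _ _ _
  have hS := (hsur.comp hline 0).hasDerivAt
  set G' := deriv (logRate ∘ line) 0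
  set S' := deriv (surrogate x ∘ line) 0
  -- Tangency: `surrogate x + logRate` is at least `card` along the whole line, with equality at `t
  -- = 0`.
  have hsum : S' + G' = 0 := by
    refine IsLocalMin.hasDerivAt_eq_zero (Eventually.of_forall fun t => ?_) (hS.add hG)
    have h1 := card_sub_logRate_le_surrogate x (line t)
    have h2 := surrogate_self x
    simp only [Pi.add_apply, Function.comp_apply, hline0]
    linarith
  have hS0 : 0 ≤ S' := by
    refine ge_of_tendsto (hasDerivWithinAt_iff_tendsto_slope' (s := Set.Ioi (0 : ℝ))
      (by simp) |>.1 hS.hasDerivWithinAt) ?_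
    filter_upwards [Ioo_mem_nhdsGT (zero_lt_one (α := ℝ))] with t ht
    have hmem : line t ∈ N.feasible :=
      convex_feasible.add_smul_sub_mem hx hy ⟨ht.1.le, ht.2.le⟩
    rw [slope_def_field]
    refine div_nonneg ?_ (by linarith [ht.1])
    simp only [Function.comp_apply, hline0, sub_nonneg]
    exact hmin hmem
  have hr (p : N.Link) := ((differentiable_rate p).comp hline 0).hasDerivAt
  have hterm (p : N.Link) : ∃ D ≤ deriv ((fun w => rate w p) ∘ line) 0, HasDerivWithinAt
      (fun t => if p.tx = 0 then tau (line t) p else rate (line t) p) D (Set.Ici 0) 0 := by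
    by_cases hp : p.tx = 0
    · simp only [hp, if_true]
      exact exists_hasDerivWithinAt_min (hr p) (by simpa [hline0] using hcap p hp)
    · simp only [hp, if_false]
      exact ⟨_, le_rfl, (hr p).hasDerivWithinAt⟩
  choose D hDle hD using hterm
  refine ⟨∑ p, D p, (Finset.sum_le_sum fun p _ => hDle p).trans ?_,
    HasDerivWithinAt.fun_sum fun p _ => hD p⟩
  have h1 := HasDerivAt.fun_sum (u := Finset.univ) fun p _ => hr p
  have h2 := hG.const_mul (N.β / Real.log 2)
  have h3 := h1.unique (h2.congr_of_eventuallyEq (Eventually.of_forall fun t => sum_rate_eq _))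
  rw [h3]
  have : 0 ≤ N.β / Real.log 2 := div_nonneg N.β_pos.le (Real.log_nonneg one_le_two)
  nlinarith

theorem Run.isStationary_of_mapClusterPt (run : N.Run) {x : N.Beams}
    (hx : MapClusterPt x atTop run.w) : IsStationary x := by
  obtain ⟨ψ, hψ, hlim⟩ := hx.tendsto_subseq
  have hlam := hψ.tendsto_atTop.eventually run.eventually_lam_eq_one
  obtain ⟨L, hL⟩ := run.exists_tendsto_logRate
  have hLx : L = logRate x := tendsto_nhds_unique (hL.comp hψ.tendsto_atTop)
    ((differentiable_logRate.continuous.tendsto x).comp hlim)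
  refine isStationary_of_isMinOn_surrogate
    (isClosed_feasible.mem_of_tendsto hlim (hψ.tendsto_atTop.eventually run.eventually_w_mem_feasible)) ?_ ?_
  · intro y hy
    have h1 : Tendsto (fun k => surrogate (run.w (ψ k)) y) atTop (𝓝 (surrogate x y)) :=
      ((continuous_surrogate_left y).tendsto x).comp hlim
    -- The successors `run.w (ψ k + 1)` need not converge; their `logRate` does, since the whole
    -- sequence of values converges.
    have h2 : Tendsto (fun k => Fintype.card N.Link - logRate (run.w (ψ k + 1))) atTop
        (𝓝 (Fintype.card N.Link - L)) :=
      tendsto_const_nhds.sub (((tendsto_add_atTop_iff_nat 1).2 hL).comp hψ.tendsto_atTop)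
    have h3 := le_of_tendsto_of_tendsto h2 h1 (hlam.mono fun k hk =>
      (card_sub_logRate_le_surrogate _ _).trans (run.surrogate_succ_le hk hy))
    rw [hLx, ← surrogate_self] at h3
    exact h3
  · intro p hp
    exact le_of_tendsto (((differentiable_rate p).continuous.tendsto x).comp hlim)
      (hlam.mono fun k hk => run.rate_le_of_lam_eq_one hk hp)

end Network

theorem lemma1 (N : Network) (w₀ : N.Beams) :
    (∃ run : N.Run, run.w 0 = w₀) ∧
    ∀ run : N.Run, run.w 0 = w₀ →
      (∃ x, MapClusterPt x atTop run.w) ∧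
      (∃ L : ℝ, Tendsto (fun m => Network.sumRate (run.w m)) atTop (𝓝 L) ∧
        ∀ x, MapClusterPt x atTop run.w → Network.IsStationary x ∧ Network.sumRate x = L) ∧
      Tendsto (fun m => Metric.infDist (run.w m) {x : N.Beams | Network.IsStationary x})
        atTop (𝓝 0) := by
  refine ⟨Network.exists_run w₀, fun run _ => ?_⟩
  refine ⟨?_, ?_, tendsto_infDist_of_mapClusterPt Network.isCompact_feasible
    run.eventually_w_mem_feasible
    fun a => run.isStationary_of_mapClusterPt⟩
  · obtain ⟨x, -, hx⟩ :=
      Network.isCompact_feasible.exists_mapClusterPt_of_frequently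
        run.eventually_w_mem_feasible.frequently
    exact ⟨x, hx⟩
  · obtain ⟨L, hL⟩ := run.exists_tendsto_logRate
    have hs : Tendsto (fun m => Network.sumRate (run.w m)) atTop (𝓝 (N.β / Real.log 2 * L)) :=
      (hL.const_mul _).congr' (run.eventually_lam_eq_one.mono fun m hm =>
        (run.sumRate_eq_of_lam_eq_one hm).symm)
    refine ⟨_, hs, fun x hx => ⟨run.isStationary_of_mapClusterPt hx, ?_⟩⟩
    obtain ⟨ψ, hψ, hlim⟩ := hx.tendsto_subseq
    exact tendsto_nhds_unique ((Network.continuous_sumRate.tendsto x).comp hlim)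
      (hs.comp hψ.tendsto_atTop)
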